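/- Let $X$ be a compact Polish space, and let $\mathcal H(X)$ be the set of all homeomorphisms of $X$ onto itself, endowed with the compact-open topology. Let $G\subseteq\mathcal H(X)$ be an uncountable $G_\delta$ set and let $B\subseteq X$ be comeager in $X$. A set is called perfect if it is nonempty, closed in the ambient space ($X$ or $\mathcal H(X)$), and has no isolated points. Then: 1. There are a dense $G_\delta$ set $W\subseteq X$ and a perfect set $Q\subseteq\mathcal H(X)$ with $Q\subseteq G$ such that $W\subseteq f[B]$ for every $f\in Q$. 2. If the set of isolated points of $X$ is not dense in $X$ (in particular, if $X$ has no isolated points), then there are a set $W\subseteq G$, dense and $G_\delta$ in the subspace $G$, and a perfect set $P\subseteq X$ such that $P\subseteq f[B]$ for every $f\in W$. -/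

import Mathlib

open Set Topology

/-- The compact-open topology on the set `X ≃ₜ X` of all homeomorphisms of `X`: the subspace topology
inherited from `C(X, X)`, which carries the compact-open topology in Mathlib. -/
instance homeoCompactOpen (X : Type*) [TopologicalSpace X] : TopologicalSpace (X ≃ₜ X) :=
  TopologicalSpace.induced (fun f : X ≃ₜ X => (f : C(X, X))) inferInstance

/-- The set of isolated points of a topological space. -/
def isolatedPoints (X : Type*) [TopologicalSpace X] : Set X :=
  {x | IsOpen ({x} : Set X)}

/-! Shrink `B` to a dense Gδ set `S`. Then `x ∈ f '' S` iff `f.symm x ∈ S`, and `(f, x) ↦ f.symm x`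
is jointly continuous. Both parts take a countable dense set `D` in one factor, each member of which
is good for comeagerly many points of the other. The points good for all of `D` form an uncountable
Gδ set, which contains a Cantor set. What is good for that whole Cantor set is Gδ by compactness and
dense because it contains `D`. For part 1, `G` is first replaced by a Cantor set inside it, and
Kuratowski–Ulam supplies `D ⊆ X`; for part 2, any countable dense `D ⊆ G` works. -/

theorem continuous_coe_homeo {X : Type*} [TopologicalSpace X] :
    Continuous fun f : X ≃ₜ X => (f : C(X, X)) :=
  continuous_induced_dom

theorem continuous_coe_homeo_symm {X : Type*} [TopologicalSpace X] [CompactSpace X] [T2Space X] :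
    Continuous fun f : X ≃ₜ X => (f.symm : C(X, X)) := by
  rw [ContinuousMap.continuous_compactOpen]
  intro K hK U hU
  have h : {f : X ≃ₜ X | MapsTo (f.symm : C(X, X)) K U} =
      {f : X ≃ₜ X | MapsTo (f : C(X, X)) Uᶜ Kᶜ} := by
    ext f
    constructor
    · intro h x hx hxK
      have := h hxK
      simp at this
      exact hx this
    · intro h y hy
      by_contra hyU
      have := h hyU
      simp at this
      exact this hy
  rw [h]
  exact (ContinuousMap.isOpen_setOfPred_mapsTo hU.isClosed_compl.isCompact
    hK.isClosed.isOpen_compl).preimage continuous_coe_homeo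

theorem continuous_homeo_symm_apply {X : Type*} [TopologicalSpace X] [CompactSpace X] [T2Space X] :
    Continuous fun p : (X ≃ₜ X) × X => p.1.symm p.2 :=
  continuous_eval.comp ((continuous_coe_homeo_symm.comp continuous_fst).prodMk continuous_snd)

/-- Pairing with the inverse makes the image closed: it is cut out by the two inverse identities.
Hence `X ≃ₜ X` is Polish. -/
theorem isClosedEmbedding_homeo_prod {X : Type*} [TopologicalSpace X] [CompactSpace X]
    [T2Space X] :
    IsClosedEmbedding fun f : X ≃ₜ X => ((f : C(X, X)), (f.symm : C(X, X))) := by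
  refine ⟨⟨?_, ?_⟩, ?_⟩
  · exact IsInducing.of_comp (continuous_coe_homeo.prodMk continuous_coe_homeo_symm)
      continuous_fst ⟨rfl⟩
  · intro f g h
    ext x
    exact DFunLike.congr_fun (congrArg Prod.fst h) x
  · have h : range (fun f : X ≃ₜ X => ((f : C(X, X)), (f.symm : C(X, X)))) =
        {p | p.1.comp p.2 = ContinuousMap.id X} ∩ {p | p.2.comp p.1 = ContinuousMap.id X} := by
      ext ⟨a, b⟩
      constructor
      · rintro ⟨f, hf⟩
        obtain ⟨rfl, rfl⟩ := Prod.mk.inj hf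
        exact ⟨by ext x; simp, by ext x; simp⟩
      · rintro ⟨h₁, h₂⟩
        exact ⟨{ toFun := a, invFun := b,
                 left_inv := fun x => DFunLike.congr_fun h₂ x
                 right_inv := fun x => DFunLike.congr_fun h₁ x
                 continuous_toFun := a.continuous
                 continuous_invFun := b.continuous }, rfl⟩
    rw [h]
    exact (isClosed_eq (continuous_fst.compCM continuous_snd) continuous_const).inter
      (isClosed_eq (continuous_snd.compCM continuous_fst) continuous_const)

theorem polishSpace_continuousMap {X Y : Type*} [TopologicalSpace X] [CompactSpace X]
    [SecondCountableTopology X] [LocallyCompactSpace X] [TopologicalSpace Y] [PolishSpace Y] :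
    PolishSpace C(X, Y) := by
  let := TopologicalSpace.upgradeIsCompletelyMetrizable Y
  infer_instance

theorem polishSpace_homeo {X : Type*} [TopologicalSpace X] [CompactSpace X] [PolishSpace X] :
    PolishSpace (X ≃ₜ X) :=
  haveI : PolishSpace C(X, X) := polishSpace_continuousMap
  isClosedEmbedding_homeo_prod.polishSpace

/-- A finer Polish topology makes `S` closed; a Cantor set found there stays continuous in the
coarser one. -/
theorem IsGδ.exists_nat_bool_injection_of_not_countable {α : Type*} [TopologicalSpace α]
    [PolishSpace α] {S : Set α} (hS : IsGδ S) (hSu : ¬ S.Countable) :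
    ∃ g : (ℕ → Bool) → α, range g ⊆ S ∧ Continuous g ∧ Function.Injective g := by
  let := borel α
  have : BorelSpace α := ⟨rfl⟩
  obtain ⟨t, ht, hpol, hcl, -⟩ := hS.measurableSet.isClopenable
  obtain ⟨g, hg, hc, hi⟩ :=
    @IsClosed.exists_nat_bool_injection_of_not_countable α t hpol S hcl hSu
  exact ⟨g, hg, continuous_le_rng ht hc, hi⟩

theorem preperfect_univ_nat_bool : Preperfect (univ : Set (ℕ → Bool)) := by
  intro x _
  rw [accPt_iff_nhds]
  intro U hU
  have h : Filter.Tendsto (fun n => Function.update x n (!x n)) Filter.atTop (𝓝 x) := by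
    rw [tendsto_pi_nhds]
    intro i
    refine tendsto_const_nhds.congr' ?_
    filter_upwards [Filter.eventually_gt_atTop i] with n hn
    rw [Function.update_of_ne hn.ne]
  obtain ⟨n, hn⟩ := (h.eventually_mem hU).exists
  refine ⟨_, ⟨hn, mem_univ _⟩, fun he => ?_⟩
  have := congrFun he n
  simp at this

theorem perfect_range_nat_bool {α : Type*} [TopologicalSpace α] [T2Space α]
    {g : (ℕ → Bool) → α} (hg : Continuous g) (hi : Function.Injective g) : Perfect (range g) := by
  refine ⟨(isCompact_range hg).isClosed, ?_⟩
  rintro _ ⟨c, rfl⟩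
  have := (preperfect_univ_nat_bool c (mem_univ c)).map hg.continuousAt hi
  rwa [Filter.map_principal, image_univ] at this

/-- A countable set of non-isolated points is meagre, so deleting it from `M` leaves a set still
meeting `U`. -/
theorem not_countable_inter_of_mem_residual {α : Type*} [TopologicalSpace α] [T1Space α]
    [BaireSpace α] {M U : Set α} (hM : M ∈ residual α) (hU : IsOpen U) (hne : U.Nonempty)
    (hiso : ∀ x ∈ U, ¬ IsOpen ({x} : Set α)) : ¬ (M ∩ U).Countable := by
  intro hc
  have h : (⋂ x ∈ M ∩ U, ({x}ᶜ : Set α)) ∈ residual α := by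
    refine (countable_bInter_mem hc).2 fun x hx => ?_
    refine residual_of_dense_open isOpen_compl_singleton ?_
    exact dense_compl_singleton_iff_not_open.2 (hiso x hx.2)
  obtain ⟨x, hxU, hxM, hx⟩ :=
    (dense_of_mem_residual (Filter.inter_mem hM h)).inter_open_nonempty U hU hne
  exact mem_iInter₂.1 hx x ⟨hxM, hxU⟩ rfl

/-- By the tube lemma, each open set in the intersection gives an open condition on `y`. -/
theorem IsGδ.setOf_forall_of_compactSpace {Y K Z : Type*} [TopologicalSpace Y]
    [TopologicalSpace K] [CompactSpace K] [TopologicalSpace Z] {e : Y × K → Z}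
    (he : Continuous e) {S : Set Z} (hS : IsGδ S) : IsGδ {y | ∀ k, e (y, k) ∈ S} := by
  obtain ⟨O, hO, rfl⟩ := isGδ_iff_eq_iInter_nat.1 hS
  have h : {y | ∀ k, e (y, k) ∈ ⋂ n, O n} = ⋂ n, {y | ∀ k, e (y, k) ∈ O n} := by
    ext y
    simp only [mem_iInter, mem_ofPred_eq]
    exact forall_comm
  rw [h]
  refine .iInter_of_isOpen fun n => isOpen_iff_mem_nhds.2 fun y hy => ?_
  have := isCompact_univ.eventually_forall_of_forall_eventually (x₀ := y)
    (P := fun y k => e (y, k) ∈ O n)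
    (fun k _ => ((hO n).preimage he).mem_nhds (hy k))
  filter_upwards [this] with z hz k using hz k (mem_univ k)

/-- The topological form of Fubini's theorem (Kuratowski and Ulam) for dense open sets. -/
theorem IsOpen.setOf_dense_section_mem_residual {Y Z : Type*} [TopologicalSpace Y]
    [SecondCountableTopology Y] [TopologicalSpace Z] {O : Set (Y × Z)} (hO : IsOpen O)
    (hd : ∀ y, Dense {z | (y, z) ∈ O}) : {z | Dense {y | (y, z) ∈ O}} ∈ residual Z := by
  have hb := TopologicalSpace.isBasis_countableBasis Y
  have h : (⋂ V ∈ TopologicalSpace.countableBasis Y, {z | ∃ y ∈ V, (y, z) ∈ O}) ∈ residual Z := by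
    refine (countable_bInter_mem (TopologicalSpace.countable_countableBasis Y)).2 fun V hV => ?_
    obtain ⟨y₀, hy₀⟩ := TopologicalSpace.nonempty_of_mem_countableBasis hV
    refine residual_of_dense_open ?_ ((hd y₀).mono fun z hz => ⟨y₀, hy₀, hz⟩)
    have : {z | ∃ y ∈ V, (y, z) ∈ O} = ⋃ y ∈ V, {z | (y, z) ∈ O} := by
      ext z; simp
    rw [this]
    exact isOpen_biUnion fun y _ => hO.preimage (Continuous.prodMk_right y)
  refine Filter.mem_of_superset h fun z hz => ?_
  rw [mem_ofPred_eq, hb.dense_iff]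
  intro V hV hVne
  obtain ⟨y, hyV, hy⟩ := mem_iInter₂.1 hz V hV
  exact ⟨y, hyV, hy⟩

theorem setOf_section_mem_residual {Y Z T : Type*} [TopologicalSpace Y]
    [SecondCountableTopology Y] [TopologicalSpace Z] [TopologicalSpace T] {e : Y × Z → T}
    (he : Continuous e) {S : Set T} (hS : IsGδ S) (hd : ∀ y, Dense {z | e (y, z) ∈ S}) :
    {z | {y | e (y, z) ∈ S} ∈ residual Y} ∈ residual Z := by
  obtain ⟨O, hO, rfl⟩ := isGδ_iff_eq_iInter_nat.1 hS
  have h := (eventually_countable_forall (l := residual Z)).2 fun n =>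
    ((hO n).preimage he).setOf_dense_section_mem_residual fun y =>
      (hd y).mono fun z (hz : e (y, z) ∈ ⋂ n, O n) => mem_iInter.1 hz n
  filter_upwards [h] with z hz
  have h' := (eventually_countable_forall (l := residual Y)).2 fun n =>
    residual_of_dense_open ((hO n).preimage (he.comp (Continuous.prodMk_left z))) (hz n)
  filter_upwards [h'] with y hy
  exact mem_iInter.2 hy

theorem exists_dense_isGδ_subset_image_of_perfect {X : Type*} [TopologicalSpace X]
    [CompactSpace X] [PolishSpace X] {G : Set (X ≃ₜ X)} (hG : IsGδ G) (hGu : ¬ G.Countable)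
    {S : Set X} (hS : IsGδ S) (hSd : Dense S) :
    ∃ (W : Set X) (Q : Set (X ≃ₜ X)), IsGδ W ∧ Dense W ∧ Perfect Q ∧ Q.Nonempty ∧ Q ⊆ G ∧
      ∀ f ∈ Q, W ⊆ f '' S := by
  have := polishSpace_homeo (X := X)
  obtain ⟨g, hgG, hgc, hgi⟩ := hG.exists_nat_bool_injection_of_not_countable hGu
  have he : Continuous fun p : (ℕ → Bool) × X => (g p.1).symm p.2 :=
    continuous_homeo_symm_apply.comp ((hgc.comp continuous_fst).prodMk continuous_snd)
  -- Each section is the preimage of `S` under a homeomorphism, hence dense.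
  have hA := setOf_section_mem_residual he hS fun c => hSd.preimage (g c).symm.isOpenMap
  obtain ⟨D, hDA, hDc, hDd⟩ := (dense_of_mem_residual hA).exists_countable_dense_subset
  have hM : IsGδ (⋂ x ∈ D, {c | (g c).symm x ∈ S}) :=
    .biInter hDc fun x _ => hS.preimage (he.comp (Continuous.prodMk_left x))
  have hMr : (⋂ x ∈ D, {c | (g c).symm x ∈ S}) ∈ residual (ℕ → Bool) :=
    (countable_bInter_mem hDc).2 fun x hx => hDA hx
  have hMu := not_countable_inter_of_mem_residual hMr isOpen_univ univ_nonempty fun c _ ho => by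
    have := preperfect_univ_nat_bool c (mem_univ c)
    rw [accPt_iff_nhds] at this
    obtain ⟨y, hy, hne⟩ := this {c} (ho.mem_nhds rfl)
    exact hne hy.1
  rw [inter_univ] at hMu
  have : PolishSpace (ℕ → Bool) := { }
  obtain ⟨k, hkM, hkc, hki⟩ := hM.exists_nat_bool_injection_of_not_countable hMu
  refine ⟨{x | ∀ c, (g (k c)).symm x ∈ S}, range (g ∘ k), ?_, ?_,
    perfect_range_nat_bool (hgc.comp hkc) (hgi.comp hki), range_nonempty _,
    (range_comp_subset_range k g).trans hgG, ?_⟩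
  · exact hS.setOf_forall_of_compactSpace (e := fun p : X × (ℕ → Bool) => (g (k p.2)).symm p.1)
      (he.comp ((hkc.comp continuous_snd).prodMk continuous_fst))
  · exact hDd.mono fun x hx c => mem_iInter₂.1 (hkM (mem_range_self c)) x hx
  · rintro _ ⟨c, rfl⟩ x hx
    exact ⟨_, hx c, (g (k c)).apply_symm_apply x⟩

theorem exists_perfect_subset_image_of_dense_isGδ {X : Type*} [TopologicalSpace X]
    [CompactSpace X] [PolishSpace X] (G : Set (X ≃ₜ X)) {S : Set X} (hS : IsGδ S) (hSd : Dense S)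
    (hX : ¬ Dense (isolatedPoints X)) :
    ∃ (W : Set G) (P : Set X), IsGδ W ∧ Dense W ∧ Perfect P ∧ P.Nonempty ∧
      ∀ f ∈ W, P ⊆ (f : X ≃ₜ X) '' S := by
  have := polishSpace_homeo (X := X)
  obtain ⟨D, hDc, hDd⟩ := TopologicalSpace.exists_countable_dense G
  have hM : IsGδ (⋂ f ∈ D, {x | (f : X ≃ₜ X).symm x ∈ S}) :=
    .biInter hDc fun f _ => hS.preimage (f : X ≃ₜ X).symm.continuous
  have hMr : (⋂ f ∈ D, {x | (f : X ≃ₜ X).symm x ∈ S}) ∈ residual X :=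
    (countable_bInter_mem hDc).2 fun f _ =>
      residual_of_dense_Gδ (hS.preimage (f : X ≃ₜ X).symm.continuous)
        (hSd.preimage (f : X ≃ₜ X).symm.isOpenMap)
  have hU : IsOpen (closure (isolatedPoints X))ᶜ := isClosed_closure.isOpen_compl
  have hne : ((closure (isolatedPoints X))ᶜ).Nonempty :=
    nonempty_compl.2 fun h => hX (dense_iff_closure_eq.2 h)
  have hMu := not_countable_inter_of_mem_residual hMr hU hne fun x hx ho => hx (subset_closure ho)
  obtain ⟨k, hkM, hkc, hki⟩ :=
    (hM.inter hU.isGδ).exists_nat_bool_injection_of_not_countable hMu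
  refine ⟨{f | ∀ c, (f : X ≃ₜ X).symm (k c) ∈ S}, range k, ?_, ?_,
    perfect_range_nat_bool hkc hki, range_nonempty _, ?_⟩
  · exact hS.setOf_forall_of_compactSpace
      (e := fun p : G × (ℕ → Bool) => (p.1 : X ≃ₜ X).symm (k p.2))
      (continuous_homeo_symm_apply.comp
        ((continuous_subtype_val.comp continuous_fst).prodMk (hkc.comp continuous_snd)))
  · exact hDd.mono fun f hf c => mem_iInter₂.1 (hkM (mem_range_self c)).1 f hf
  · rintro f hf _ ⟨c, rfl⟩
    exact ⟨_, hf c, (f : X ≃ₜ X).apply_symm_apply _⟩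

theorem mainTheorem11 {X : Type*} [TopologicalSpace X] [CompactSpace X] [PolishSpace X]
    (G : Set (X ≃ₜ X)) (hG : IsGδ G) (hGu : ¬ G.Countable)
    (B : Set X) (hB : B ∈ residual X) :
    (∃ (W : Set X) (Q : Set (X ≃ₜ X)),
        IsGδ W ∧ Dense W ∧
        Perfect Q ∧ Q.Nonempty ∧ Q ⊆ G ∧
        ∀ f ∈ Q, W ⊆ f '' B) ∧
    (¬ Dense (isolatedPoints X) →
      ∃ (W : Set G) (P : Set X),
        IsGδ W ∧ Dense W ∧
        Perfect P ∧ P.Nonempty ∧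
        ∀ f ∈ W, P ⊆ (f : X ≃ₜ X) '' B) := by
  obtain ⟨S, hSB, hS, hSd⟩ := mem_residual.1 hB
  constructor
  · obtain ⟨W, Q, hW, hWd, hQ, hQn, hQG, h⟩ :=
      exists_dense_isGδ_subset_image_of_perfect hG hGu hS hSd
    exact ⟨W, Q, hW, hWd, hQ, hQn, hQG, fun f hf => (h f hf).trans (image_mono hSB)⟩
  · intro hX
    obtain ⟨W, P, hW, hWd, hP, hPn, h⟩ := exists_perfect_subset_image_of_dense_isGδ G hS hSd hX
    exact ⟨W, P, hW, hWd, hP, hPn, fun f hf => (h f hf).trans (image_mono hSB)⟩
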